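/- Let $n\ge 5$, $N=\{1,\dots,n\}$, $A=\{ij : i,j\in N,\ i\ne j\}$, $N_1=N\setminus\{1\}$ and $A_1=\{ij : i,j\in N_1,\ i\neq j\}$. Let $\mathcal C_1$ be the set of (arc sets of) directed cycles, of length at least $2$ and without repeated nodes, all of whose arcs lie in $A_1$, and let $$D=\Big\{d\in\mathbb R^{A_1} : d_{ij}>0\ \text{for all } ij\in A_1,\ \sum_{ij\in C}d_{ij}\le 1\ \text{for all } C\in\mathcal C_1\Big\}.$$ Let $P_{\mathrm{AP}}$ be the set of $x\in[0,1]^A$ such that $\sum_{j\ne i}x_{ij}=1$ and $\sum_{j\neq i}x_{ji}=1$ for all $i\in N$. For $d\in D$, let $P_{\mathrm{DL}}(d)$ be the set of $x\in P_{\mathrm{AP}}$ for which there exists $u\in\mathbb R^{N_1}$ with $$u_i-u_j+x_{ij}+(1-d_{ij}-d_{ji})x_{ji}\le 1-d_{ij}\qquad\text{for all } ij\in A_1 .$$ **Proposition.** Let $d\in D$ and $\delta\in\mathbb R^{A_1}\setminus\{0\}$ be such that $d+\delta\in D$ and $\delta_{ij}=-\delta_{ji}$ for all $ij\in A_1$,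 and assume that there exists $\hat C\in\mathcal C_1$ with $|\hat C|\ge 3$ such that $\sum_{ij\in\hat C}\delta_{ij}\ne 0$. Then $P_{\mathrm{DL}}(d)$ and $P_{\mathrm{DL}}(d+\delta)$ are not comparable, that is, $P_{\mathrm{DL}}(d)\not\subseteq P_{\mathrm{DL}}(d+\delta)$ and $P_{\mathrm{DL}}(d+\delta)\not\subseteq P_{\mathrm{DL}}(d)$. -/

import Mathlib

namespace ATSP

/-- The node set `N = {1, …, n}`; the node called `i` in the text is `i - 1 : Fin n`, so that the
special node `1` is the element with value `0`. -/
abbrev Node (n : ℕ) : Type := Fin n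

/-- The set `N₁ = N \ {1}` of all nodes except the special one. -/
abbrev Node₁ (n : ℕ) : Type := {i : Node n // i.val ≠ 0}

/-- The arcs `ij`, `i ≠ j`, of the complete directed graph on `V`, written as `(i, j)`. -/
abbrev Arc (V : Type) : Type := {a : V × V // a.1 ≠ a.2}

/-- The arc `ji` for an arc `ij`. -/
def Arc.rev {V : Type} (a : Arc V) : Arc V := ⟨(a.1.2, a.1.1), a.2.symm⟩

/-- The inclusion of `A₁` (the arcs that avoid the special node) in the set `A` of all arcs. -/
def Arc.incl {n : ℕ} (a : Arc (Node₁ n)) : Arc (Node n) :=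
  ⟨(a.1.1.1, a.1.2.1), fun h => a.2 (Subtype.ext h)⟩

/-- `C` is the arc set of a directed cycle: for some `k ≥ 2` and distinct nodes
`v₀, …, v₍ₖ₋₁₎`, its arcs are exactly `v₀v₁, v₁v₂, …, v₍ₖ₋₁₎v₀`. (`finRotate k` is the cyclic shift
`t ↦ t + 1` of `Fin k`.) -/
def IsDirectedCycle {V : Type} (C : Finset (Arc V)) : Prop :=
  ∃ k : ℕ, 2 ≤ k ∧ ∃ v : Fin k → V, Function.Injective v ∧
    ∀ a : Arc V, a ∈ C ↔ ∃ t : Fin k, a.1 = (v t, v (finRotate k t))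

/-- The set `𝒞₁` of directed cycles with arcs in `A₁`. -/
def cycles₁ (n : ℕ) : Set (Finset (Arc (Node₁ n))) := {C | IsDirectedCycle C}

/-- The parameter set `D`: strictly positive vectors indexed by `A₁` whose sum over every cycle in
`𝒞₁` is at most `1`. -/
def paramD (n : ℕ) : Set (Arc (Node₁ n) → ℝ) :=
  {d | (∀ a, 0 < d a) ∧ ∀ C ∈ cycles₁ n, ∑ a ∈ C, d a ≤ 1}

/-- The polytope `P_AP` of the (restricted) assignment problem. -/
def assignmentPolytope (n : ℕ) : Set (Arc (Node n) → ℝ) :=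
  {x | (∀ a, 0 ≤ x a ∧ x a ≤ 1) ∧
    (∀ i : Node n, ∑ a : Arc (Node n) with a.1.1 = i, x a = 1) ∧
    (∀ i : Node n, ∑ a : Arc (Node n) with a.1.2 = i, x a = 1)}

/-- The polyhedron `Q_DL(d)` of the extended `d`-DL formulation, in the variables `(x, u)`:
`u_i - u_j + x_ij + (1 - d_ij - d_ji) x_ji ≤ 1 - d_ij` for all `ij ∈ A₁`. -/
def polyQDL (n : ℕ) (d : Arc (Node₁ n) → ℝ) : Set ((Arc (Node n) → ℝ) × (Node₁ n → ℝ)) :=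
  {p | p.1 ∈ assignmentPolytope n ∧ ∀ a : Arc (Node₁ n),
    p.2 a.1.1 - p.2 a.1.2 + p.1 a.incl + (1 - d a - d a.rev) * p.1 a.rev.incl ≤ 1 - d a}

/-- `P_DL(d)`: the projection of `Q_DL(d)` onto the `x`-variables. -/
def polyPDL (n : ℕ) (d : Arc (Node₁ n) → ℝ) : Set (Arc (Node n) → ℝ) :=
  Prod.fst '' polyQDL n d

end ATSP

/-! Along a directed cycle the labels `u` telescope, so summing the constraints over its arcs bounds
a linear expression in `x` alone. If a point of `P_DL(d)` makes the constraint of every arc of the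
cycle tight with equal labels, then raising the sum of `d` over that cycle cuts the point off.

Such points are built for cycles `σ` through all nodes of `N₁` but one, `w`. Arc `i → σ i` carries
`1 - d`, the remaining `d` goes from `i` to `w`, and `w` together with node 1 restores the degree
equations. Labels are 0 on the cycle and a suitable `U` at `w` (`exists_label`). If `δ` has positive
sum along `σ`, the point is not in `P_DL(d + δ)`.

A suitable `σ` exists: if an antisymmetric `δ` vanished on all cycles missing one node, it would be
a potential difference (`exists_potential`) and so vanish on every cycle. Reversing `σ` flips the
sign of the sum, which gives both non-inclusions. -/

namespace ATSP

open Finset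

/-! ### Cycle sums as sums over cyclic permutations. -/

section Extension

variable {V : Type} [DecidableEq V]

/-- The extension of an arc vector to all pairs of nodes by zero on the diagonal. -/
def extendZero (f : Arc V → ℝ) (i j : V) : ℝ :=
  if h : i ≠ j then f ⟨(i, j), h⟩ else 0

@[simp] theorem extendZero_self (f : Arc V → ℝ) (i : V) : extendZero f i i = 0 := by
  simp [extendZero]

theorem extendZero_of_ne (f : Arc V → ℝ) {i j : V} (h : i ≠ j) :
    extendZero f i j = f ⟨(i, j), h⟩ := by
  simp [extendZero, h]

theorem extendZero_arc (f : Arc V → ℝ) (a : Arc V) : extendZero f a.1.1 a.1.2 = f a :=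
  extendZero_of_ne f a.2

theorem extendZero_antisymm {f : Arc V → ℝ} (hf : ∀ a, f a = -f a.rev) (i j : V) :
    extendZero f i j = -extendZero f j i := by
  by_cases h : i = j
  · subst h; simp
  · rw [extendZero_of_ne f h, extendZero_of_ne f (Ne.symm h), hf]
    rfl

theorem extendZero_neg (f : Arc V → ℝ) (i j : V) :
    extendZero (-f) i j = -extendZero f i j := by
  by_cases h : i = j
  · subst h; simp
  · simp [extendZero_of_ne _ h]

theorem finRotate_ne_self {k : ℕ} (hk : 2 ≤ k) (t : Fin k) : finRotate k t ≠ t := by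
  obtain ⟨m, rfl⟩ : ∃ m, k = m + 2 := ⟨k - 2, by omega⟩
  have := isCycle_finRotate (n := m)
  have hs : (finRotate (m + 2)).support = univ := support_finRotate
  exact Equiv.Perm.mem_support.1 (hs ▸ mem_univ t)

/-- The sum of an arc vector over a cycle, in terms of the sequence of its nodes. -/
theorem sum_cycle_eq (f : Arc V → ℝ) {C : Finset (Arc V)} {k : ℕ} (hk : 2 ≤ k)
    {v : Fin k → V} (hv : Function.Injective v)
    (hC : ∀ a : Arc V, a ∈ C ↔ ∃ t : Fin k, a.1 = (v t, v (finRotate k t))) :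
    ∑ a ∈ C, f a = ∑ t, extendZero f (v t) (v (finRotate k t)) := by
  have hne : ∀ t, v t ≠ v (finRotate k t) := fun t h => finRotate_ne_self hk t (hv h).symm
  symm
  refine Finset.sum_bij (fun t _ => (⟨(v t, v (finRotate k t)), hne t⟩ : Arc V)) ?_ ?_ ?_ ?_
  · intro t _
    exact (hC _).2 ⟨t, rfl⟩
  · intro t _ t' _ h
    exact hv (congrArg (fun a : Arc V => a.1.1) h)
  · intro a ha
    obtain ⟨t, ht⟩ := (hC a).1 ha
    exact ⟨t, mem_univ _, Subtype.ext ht.symm⟩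
  · intro t _
    exact extendZero_of_ne f (hne t)

/-- A cyclic permutation traverses a directed cycle. -/
theorem exists_cycle_of_isCycle [Fintype V] {σ : Equiv.Perm V} (hσ : σ.IsCycle) :
    ∃ C : Finset (Arc V), IsDirectedCycle C ∧
      ∀ f : Arc V → ℝ, ∑ a ∈ C, f a = ∑ i, extendZero f i (σ i) := by
  obtain ⟨x, hx, hxy⟩ := id hσ
  obtain ⟨m, hm⟩ : ∃ m, orderOf σ = m + 2 :=
    ⟨orderOf σ - 2, by have := hσ.two_le_card_support; rw [← hσ.orderOf] at this; omega⟩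
  let v : Fin (m + 2) → V := fun t => (σ ^ (t : ℕ)) x
  have hrot : ∀ t, v (finRotate (m + 2) t) = σ (v t) := by
    intro t
    have h1 : ((finRotate (m + 2) t : Fin (m + 2)) : ℕ) = (t + 1) % orderOf σ := by
      rw [finRotate_apply, hm, Fin.val_add]
      simp
    simp only [v]
    rw [h1, pow_mod_orderOf, pow_succ', Equiv.Perm.mul_apply]
  have hv : Function.Injective v := by
    intro s t hst
    have h2 : σ ^ (s : ℕ) = σ ^ (t : ℕ) := hσ.pow_eq_pow_iff.2 ⟨x, hx, hst⟩
    rw [pow_inj_mod, hm, Nat.mod_eq_of_lt s.2, Nat.mod_eq_of_lt t.2] at h2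
    exact Fin.ext h2
  classical
  let C : Finset (Arc V) :=
    (univ : Finset (Arc V)).filter (fun a => ∃ t, a.1 = (v t, v (finRotate (m + 2) t)))
  have hC : ∀ a : Arc V, a ∈ C ↔ ∃ t, a.1 = (v t, v (finRotate (m + 2) t)) := by
    intro a
    simp [C]
  refine ⟨C, ⟨m + 2, by omega, v, hv, hC⟩, fun f => ?_⟩
  rw [sum_cycle_eq f (by omega) hv hC]
  simp only [hrot]
  have himg : ∑ t, extendZero f (v t) (σ (v t))
      = ∑ i ∈ univ.image v, extendZero f i (σ i) := by
    rw [Finset.sum_image (fun a _ b _ h => hv h)]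
  rw [himg]
  -- Nodes off the orbit are fixed by `σ` and contribute the zero diagonal.
  refine Finset.sum_subset (subset_univ _) fun i _ hi => ?_
  have : σ i = i := by
    by_contra hne
    obtain ⟨q, hq⟩ := (hxy hne).exists_pow_eq'
    apply hi
    exact mem_image.2 ⟨⟨q, hm ▸ hq.1⟩, mem_univ _, hq.2⟩
  rw [this, extendZero_self]

end Extension

/-! ### Antisymmetric weights and potentials. -/

section Triangles

variable {V : Type} [DecidableEq V] [Fintype V]

/-- If an antisymmetric matrix has zero sum along every cycle that misses exactly one node, then
the weight of a path of length two does not depend on its middle node. -/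
theorem two_path_eq {g : V → V → ℝ} (hg : ∀ i j, g i j = -g j i)
    (h0 : ∀ (σ : Equiv.Perm V) (w : V), σ.IsCycle → σ.support = {w}ᶜ → ∑ i, g i (σ i) = 0)
    {a b c w : V} (hab : a ≠ b) (hac : a ≠ c) (haw : a ≠ w) (hbc : b ≠ c) (hbw : b ≠ w)
    (hcw : c ≠ w) : g a c + g c b = g a w + g w b := by
  have hdiag : ∀ i, g i i = 0 := fun i => by linarith [hg i i]
  let l : List V := (univ \ {a, c, b, w} : Finset V).toList
  have hl : ∀ i, i ∈ l ↔ i ≠ a ∧ i ≠ c ∧ i ≠ b ∧ i ≠ w := by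
    intro i
    simp [l]
  have hnd : (a :: c :: b :: l).Nodup := by
    have : l.Nodup := Finset.nodup_toList _
    simp [hl, this, hab, hac, hbc.symm]
  let σ := (a :: c :: b :: l).formPerm
  have hcyc : σ.IsCycle := List.isCycle_formPerm hnd (by simp)
  have hsupp : σ.support = {w}ᶜ := by
    rw [List.support_formPerm_of_nodup _ hnd (by simp)]
    ext i
    simp only [List.toFinset_cons, mem_insert, List.mem_toFinset, hl, mem_compl, mem_singleton]
    constructor
    · rintro (rfl | rfl | rfl | h)
      exacts [haw, hcw, hbw, h.2.2.2]
    · intro h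
      tauto
  have hσw : σ w = w := Equiv.Perm.notMem_support.1 (by simp [hsupp])
  have hσa : σ a = c := List.formPerm_apply_head _ _ _ hnd
  have hσc : σ c = b := by
    have := List.formPerm_apply_lt_getElem (a :: c :: b :: l) hnd 1 (by simp)
    exact this
  -- Conjugating by `s` puts `w` in the place of `c`: the new cycle misses `c` and differs from `σ`
  -- only on the stretch from `a` to `b`.
  let s : Equiv.Perm V := Equiv.swap c w
  have hτ : ∑ i, g i ((s * σ * s⁻¹) i) = 0 := by
    refine h0 _ c (hcyc.conj) ?_
    rw [Equiv.Perm.support_conj, hsupp]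
    ext i
    simp only [Finset.mem_map_equiv, mem_compl, mem_singleton, s, Equiv.symm_swap]
    rw [Equiv.swap_apply_eq_iff, Equiv.swap_apply_right]
  have hσ0 := h0 σ w hcyc hsupp
  have hτ' : ∑ i, g (s i) (s (σ i)) = 0 := by
    rw [← hτ, ← Equiv.sum_comp s fun i => g i ((s * σ * s⁻¹) i)]
    refine Finset.sum_congr rfl fun i _ => ?_
    rw [Equiv.Perm.mul_apply, Equiv.Perm.mul_apply, ← Equiv.Perm.mul_apply s⁻¹ s, inv_mul_cancel,
      Equiv.Perm.one_apply]
  have hdiff : ∑ i, (g (s i) (s (σ i)) - g i (σ i)) = 0 := by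
    rw [Finset.sum_sub_distrib, hτ', hσ0, sub_zero]
  rw [← Finset.sum_subset (subset_univ {a, c}), Finset.sum_pair hac] at hdiff
  · rw [hσa, hσc] at hdiff
    simp only [s, Equiv.swap_apply_left, Equiv.swap_apply_of_ne_of_ne hac haw,
      Equiv.swap_apply_of_ne_of_ne hbc hbw] at hdiff
    linarith
  · intro i _ hi
    simp only [mem_insert, mem_singleton, not_or] at hi
    by_cases hiw : i = w
    · subst hiw
      rw [hσw, hdiag, hdiag, sub_zero]
    · have h1 : σ i ≠ c := fun h => hi.1 (σ.injective (h.trans hσa.symm))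
      have h2 : σ i ≠ w := fun h => hiw (σ.injective (h.trans hσw.symm))
      simp only [s]
      rw [Equiv.swap_apply_of_ne_of_ne hi.2 hiw, Equiv.swap_apply_of_ne_of_ne h1 h2, sub_self]

/-- An antisymmetric matrix with zero sum along every cycle that misses exactly one node is a
matrix of potential differences. -/
theorem exists_potential (hV : 4 ≤ Fintype.card V) {g : V → V → ℝ} (hg : ∀ i j, g i j = -g j i)
    (h0 : ∀ (σ : Equiv.Perm V) (w : V), σ.IsCycle → σ.support = {w}ᶜ → ∑ i, g i (σ i) = 0) :
    ∃ p : V → ℝ, ∀ i j, g i j = p i - p j := by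
  have hdiag : ∀ i, g i i = 0 := fun i => by linarith [hg i i]
  have htri : ∀ a b c, a ≠ b → a ≠ c → b ≠ c → g a b + g b c + g c a = 0 := by
    intro a b c hab hac hbc
    obtain ⟨w, hw⟩ : ∃ w, w ∉ ({a, b, c} : Finset V) := by
      by_contra! h
      have h1 : Fintype.card V ≤ #({a, b, c} : Finset V) :=
        Finset.card_le_card (fun i _ => h i)
      have h2 := Finset.card_le_three (a := a) (b := b) (c := c)
      omega
    simp only [mem_insert, mem_singleton, not_or] at hw
    obtain ⟨hwa, hwb, hwc⟩ : a ≠ w ∧ b ≠ w ∧ c ≠ w :=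
      ⟨Ne.symm hw.1, Ne.symm hw.2.1, Ne.symm hw.2.2⟩
    -- Each side pair of the triangle is rerouted through `w`. In the sum of the three identities
    -- the terms at `w` cancel, leaving twice the triangle sum equal to 0.
    have e1 := two_path_eq hg h0 hab.symm hbc hwb hac hwa hwc
    have e2 := two_path_eq hg h0 hbc.symm hac.symm hwc hab.symm hwb hwa
    have e3 := two_path_eq hg h0 hac hab hwa hbc.symm hwc hwb
    linarith [hg a b, hg b c, hg c a, hg a w, hg b w, hg c w]
  obtain ⟨r⟩ : Nonempty V := Fintype.card_pos_iff.1 (by omega)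
  refine ⟨fun i => g i r, fun i j => ?_⟩
  by_cases hij : i = j
  · subst hij; simp [hdiag]
  by_cases hir : i = r
  · subst hir; linarith [hg i j, hdiag i]
  by_cases hjr : j = r
  · subst hjr; linarith [hdiag j]
  linarith [htri i j r hij hir hjr, hg r i, hg j r]

/-- If some cycle has nonzero sum, then so does some cycle that misses exactly one node. -/
theorem exists_isCycle_sum_ne_zero (hV : 4 ≤ Fintype.card V) {f : Arc V → ℝ}
    (hf : ∀ a, f a = -f a.rev) {C : Finset (Arc V)} (hC : IsDirectedCycle C)
    (hne : ∑ a ∈ C, f a ≠ 0) :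
    ∃ (σ : Equiv.Perm V) (w : V), σ.IsCycle ∧ σ.support = {w}ᶜ ∧
      ∑ i, extendZero f i (σ i) ≠ 0 := by
  by_contra! h0
  obtain ⟨p, hp⟩ := exists_potential hV (extendZero_antisymm hf) h0
  obtain ⟨k, hk, v, hv, hCv⟩ := hC
  apply hne
  rw [sum_cycle_eq f hk hv hCv]
  simp only [hp, Finset.sum_sub_distrib]
  rw [Equiv.sum_comp (finRotate k) (fun t => p (v t)), sub_self]

end Triangles

/-! ### Bounds on `d` from cycles of length two and three. -/

section Parameters

variable {n : ℕ} {d : Arc (Node₁ n) → ℝ}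

theorem sum_extendZero_le_one (hd : d ∈ paramD n) {σ : Equiv.Perm (Node₁ n)} (hσ : σ.IsCycle) :
    ∑ i, extendZero d i (σ i) ≤ 1 := by
  obtain ⟨C, hC, hs⟩ := exists_cycle_of_isCycle hσ
  rw [← hs d]
  exact hd.2 C hC

theorem extendZero_nonneg (hd : d ∈ paramD n) (i j : Node₁ n) : 0 ≤ extendZero d i j := by
  unfold extendZero
  split_ifs with h
  exacts [(hd.1 _).le, le_rfl]

theorem extendZero_pair_le_one (hd : d ∈ paramD n) (i j : Node₁ n) :
    extendZero d i j + extendZero d j i ≤ 1 := by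
  by_cases h : i = j
  · subst h; simp
  · have h1 := sum_extendZero_le_one hd (Equiv.Perm.isCycle_swap h)
    rw [← Finset.sum_subset (subset_univ {i, j})] at h1
    · simpa [Finset.sum_pair h] using h1
    · intro t _ ht
      simp only [mem_insert, mem_singleton, not_or] at ht
      rw [Equiv.swap_apply_of_ne_of_ne ht.1 ht.2, extendZero_self]

theorem extendZero_le_one (hd : d ∈ paramD n) (i j : Node₁ n) : extendZero d i j ≤ 1 := by
  linarith [extendZero_pair_le_one hd i j, extendZero_nonneg hd j i]

theorem extendZero_path_le_one (hd : d ∈ paramD n) {i j w : Node₁ n} (hij : i ≠ j) (hiw : i ≠ w)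
    (hjw : j ≠ w) : extendZero d i w + extendZero d w j ≤ 1 := by
  have h1 := sum_extendZero_le_one hd
    (Equiv.Perm.isThreeCycle_swap_mul_swap_same hiw.symm hjw.symm hij).isCycle
  have h2 : ∑ t ∈ {i, w}, extendZero d t ((Equiv.swap w i * Equiv.swap w j) t) ≤ 1 :=
    (Finset.sum_le_sum_of_subset_of_nonneg (subset_univ _)
      fun t _ _ => extendZero_nonneg hd _ _).trans h1
  rw [Finset.sum_pair hiw] at h2
  simpa [Equiv.Perm.mul_apply, Equiv.swap_apply_of_ne_of_ne hiw hij,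
    Equiv.swap_apply_of_ne_of_ne hjw hij.symm] using h2

end Parameters

/-! ### The tight point, its labels and its separation. -/

section Point

variable {n : ℕ}

/-- The matrix on `N` with given blocks on `A₁`, on the arcs into and on the arcs out of the
special node. -/
def blockMatrix (Y : Node₁ n → Node₁ n → ℝ) (R S : Node₁ n → ℝ) (i j : Node n) : ℝ :=
  if hi : i.val ≠ 0 then if hj : j.val ≠ 0 then Y ⟨i, hi⟩ ⟨j, hj⟩ else R ⟨i, hi⟩
  else if hj : j.val ≠ 0 then S ⟨j, hj⟩ else 0

theorem sum_node (hn : 0 < n) (f : Node n → ℝ) :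
    ∑ i, f i = f ⟨0, hn⟩ + ∑ i : Node₁ n, f i.1 := by
  rw [← Finset.sum_subtype (univ.filter fun i : Node n => i.val ≠ 0) (by simp) f,
    ← Finset.add_sum_erase univ f (mem_univ ⟨0, hn⟩)]
  congr 2
  ext i
  simp [Fin.ext_iff]

theorem sum_arc_out (F : Node n → Node n → ℝ) (i : Node n) (h : F i i = 0) :
    ∑ a : Arc (Node n) with a.1.1 = i, F a.1.1 a.1.2 = ∑ j, F i j := by
  rw [← Finset.sum_erase univ h]
  refine Finset.sum_bij (fun a _ => a.1.2) ?_ ?_ ?_ ?_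
  · intro a ha
    simp only [mem_filter, mem_univ, true_and] at ha
    simpa [← ha] using a.2.symm
  · intro a ha b hb hab
    simp only [mem_filter, mem_univ, true_and] at ha hb
    exact Subtype.ext (Prod.ext (ha.trans hb.symm) hab)
  · intro j hj
    exact ⟨⟨(i, j), (Finset.ne_of_mem_erase hj).symm⟩, by simp, rfl⟩
  · intro a ha
    simp only [mem_filter, mem_univ, true_and] at ha
    rw [ha]

theorem sum_arc_in (F : Node n → Node n → ℝ) (i : Node n) (h : F i i = 0) :
    ∑ a : Arc (Node n) with a.1.2 = i, F a.1.1 a.1.2 = ∑ j, F j i := by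
  rw [← Finset.sum_erase univ (f := fun j => F j i) h]
  refine Finset.sum_bij (fun a _ => a.1.1) ?_ ?_ ?_ ?_
  · intro a ha
    simp only [mem_filter, mem_univ, true_and] at ha
    simpa [← ha] using a.2
  · intro a ha b hb hab
    simp only [mem_filter, mem_univ, true_and] at ha hb
    exact Subtype.ext (Prod.ext hab (ha.trans hb.symm))
  · intro j hj
    exact ⟨⟨(j, i), Finset.ne_of_mem_erase hj⟩, by simp, rfl⟩
  · intro a ha
    simp only [mem_filter, mem_univ, true_and] at ha
    rw [ha]

theorem blockMatrix_mem_assignmentPolytope (hn : 0 < n) {Y : Node₁ n → Node₁ n → ℝ}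
    {R S : Node₁ n → ℝ} (hY : ∀ i j, 0 ≤ Y i j) (hR : ∀ i, 0 ≤ R i) (hS : ∀ i, 0 ≤ S i)
    (hdiag : ∀ i, Y i i = 0)
    (hrow : ∀ i, R i + ∑ j, Y i j = 1) (hcol : ∀ j, S j + ∑ i, Y i j = 1)
    (hR1 : ∑ i, R i = 1) (hS1 : ∑ j, S j = 1) :
    (fun a : Arc (Node n) => blockMatrix Y R S a.1.1 a.1.2) ∈ assignmentPolytope n := by
  have h0 : ∀ i, blockMatrix Y R S i i = 0 := by
    intro i
    unfold blockMatrix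
    split_ifs
    exacts [hdiag _, rfl]
  have hnn : ∀ i j, 0 ≤ blockMatrix Y R S i j := by
    intro i j
    unfold blockMatrix
    split_ifs
    exacts [hY _ _, hR _, hS _, le_rfl]
  have hout : ∀ i, ∑ j, blockMatrix Y R S i j = 1 := by
    intro i
    rw [sum_node hn]
    by_cases hi : i.val = 0
    · simpa [blockMatrix, hi, fun j : Node₁ n => j.2] using hS1
    · simpa [blockMatrix, hi, fun j : Node₁ n => j.2] using hrow ⟨i, hi⟩
  have hin : ∀ j, ∑ i, blockMatrix Y R S i j = 1 := by
    intro j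
    rw [sum_node hn]
    by_cases hj : j.val = 0
    · simpa [blockMatrix, hj, fun i : Node₁ n => i.2] using hR1
    · simpa [blockMatrix, hj, fun i : Node₁ n => i.2] using hcol ⟨j, hj⟩
  refine ⟨fun a => ⟨hnn _ _, ?_⟩, fun i => ?_, fun i => ?_⟩
  · rw [← hout a.1.1]
    exact Finset.single_le_sum (f := fun j => blockMatrix Y R S a.1.1 j)
      (fun j _ => hnn _ _) (mem_univ a.1.2)
  · rw [sum_arc_out _ i (h0 i), hout]
  · rw [sum_arc_in _ i (h0 i), hin]

theorem blockMatrix_incl (Y : Node₁ n → Node₁ n → ℝ) (R S : Node₁ n → ℝ) (a : Arc (Node₁ n)) :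
    blockMatrix Y R S a.incl.1.1 a.incl.1.2 = Y a.1.1 a.1.2 := by
  simp [blockMatrix, Arc.incl, a.1.1.2, a.1.2.2]

/-- The `A₁`-part of a point of `P_DL(d)` at which the inequality of the cycle `σ`, which misses
only the node `w`, is tight. -/
def tightBlock (d : Arc (Node₁ n) → ℝ) (σ : Equiv.Perm (Node₁ n)) (w i j : Node₁ n) : ℝ :=
  if i = w then 0 else if j = w then extendZero d i (σ i)
  else if j = σ i then 1 - extendZero d i j else 0

theorem card_node₁ (hn : 0 < n) : Fintype.card (Node₁ n) = n - 1 := by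
  have h := sum_node hn (fun _ => (1 : ℝ))
  simp only [Finset.sum_const, Finset.card_univ, nsmul_eq_mul, mul_one, Fintype.card_fin] at h
  have h' : n = 1 + Fintype.card (Node₁ n) := by exact_mod_cast h
  omega

/-- Node `w` sends its whole unit to node 1. Node 1 sends `σ i` the missing `d` of arc `i → σ i`,
and sends `w` one minus the cycle sum, which is nonnegative because `d ∈ D`. -/
theorem exists_mem_assignmentPolytope (hn : 0 < n) {d : Arc (Node₁ n) → ℝ} (hd : d ∈ paramD n)
    {σ : Equiv.Perm (Node₁ n)} {w : Node₁ n} (hσ : σ.IsCycle) (hsupp : σ.support = {w}ᶜ) :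
    ∃ x ∈ assignmentPolytope n, ∀ a : Arc (Node₁ n), x a.incl = tightBlock d σ w a.1.1 a.1.2 := by
  have hσw : σ w = w := Equiv.Perm.notMem_support.1 (by simp [hsupp])
  have hmv : ∀ i, i ≠ w → σ i ≠ i := fun i hi => Equiv.Perm.mem_support.1 (by simp [hsupp, hi])
  have hσ_ne : ∀ i, i ≠ w → σ i ≠ w := fun i hi h => hi (σ.injective (h.trans hσw.symm))
  have hsum := sum_extendZero_le_one hd hσ
  have hew : extendZero d w (σ w) = 0 := by rw [hσw, extendZero_self]
  refine ⟨_, blockMatrix_mem_assignmentPolytope hn (Y := tightBlock d σ w)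
    (R := fun i => if i = w then 1 else 0)
    (S := fun j => if j = w then 1 - ∑ i, extendZero d i (σ i) else extendZero d (σ.symm j) j)
    ?_ ?_ ?_ ?_ ?_ ?_ ?_ ?_, fun a => blockMatrix_incl _ _ _ a⟩
  · intro i j
    unfold tightBlock
    split_ifs
    exacts [le_rfl, extendZero_nonneg hd _ _, sub_nonneg.2 (extendZero_le_one hd _ _), le_rfl]
  · intro i
    split_ifs <;> norm_num
  · intro j
    split_ifs
    exacts [sub_nonneg.2 hsum, extendZero_nonneg hd _ _]
  · intro i
    unfold tightBlock
    split_ifs with h1 h2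
    exacts [rfl, absurd h2.symm (hmv i h1), rfl]
  · intro i
    by_cases hi : i = w
    · simp [tightBlock, hi]
    · have : ∀ j, tightBlock d σ w i j = (if j = w then extendZero d i (σ i) else 0) +
          if j = σ i then 1 - extendZero d i (σ i) else 0 := by
        intro j
        unfold tightBlock
        by_cases h1 : j = w
        · simp [hi, h1, (hσ_ne i hi).symm]
        · by_cases h2 : j = σ i <;> simp [hi, h1, h2, hσ_ne i hi]
      simp [this, hi, Finset.sum_add_distrib]
  · intro j
    by_cases hj : j = w
    · have : ∀ i, tightBlock d σ w i w = extendZero d i (σ i) := by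
        intro i
        unfold tightBlock
        by_cases h1 : i = w
        · rw [if_pos h1, h1, hew]
        · simp [h1]
      subst hj
      simp [this]
    · have hsj : σ.symm j ≠ w := fun h => hj (by rw [← hσw, ← h, Equiv.apply_symm_apply])
      have : ∀ i, tightBlock d σ w i j =
          if i = σ.symm j then 1 - extendZero d (σ.symm j) j else 0 := by
        intro i
        unfold tightBlock
        by_cases h1 : i = σ.symm j
        · simp [h1, hsj, hj]
        · have h2 : j ≠ σ i := fun h => h1 (by rw [h, Equiv.symm_apply_apply])
          simp [h1, hj, h2]
      simp [this, hj]
  · simp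
  · rw [← Equiv.sum_comp σ]
    have : ∀ i, (if σ i = w then 1 - ∑ i, extendZero d i (σ i)
        else extendZero d (σ.symm (σ i)) (σ i)) =
        (if i = w then 1 - ∑ i, extendZero d i (σ i) else 0) + extendZero d i (σ i) := by
      intro i
      by_cases h1 : i = w
      · rw [h1, if_pos hσw, if_pos rfl, hew, add_zero]
      · rw [if_neg (hσ_ne i h1), if_neg h1, Equiv.symm_apply_apply, zero_add]
    simp only [this, Finset.sum_add_distrib, Finset.sum_ite_eq', mem_univ, if_true,
      sub_add_cancel]

/-- The label of the missed node that certifies membership in `P_DL(d)`. -/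
theorem exists_label {d : Arc (Node₁ n) → ℝ} (hd : d ∈ paramD n)
    {σ : Equiv.Perm (Node₁ n)} {w : Node₁ n} (hσ : σ.IsCycle) :
    ∃ U : ℝ, (∀ i, i ≠ w → extendZero d i (σ i) + extendZero d i w - 1 ≤ U) ∧
      ∀ j, j ≠ w → U ≤ 1 - extendZero d w j -
        (1 - extendZero d w j - extendZero d j w) * extendZero d j (σ j) := by
  have hnn := extendZero_nonneg hd
  have hle := extendZero_le_one hd
  -- `U` is the largest lower bound, from the arcs into `w`; the upper bounds come from the arcs out
  -- of `w`. The entry 0 at `w` is harmless, as every upper bound is nonnegative.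
  refine ⟨univ.sup' ⟨w, mem_univ w⟩
    fun i => if i = w then 0 else extendZero d i (σ i) + extendZero d i w - 1, ?_, ?_⟩
  · intro i hi
    refine le_trans ?_ (Finset.le_sup' _ (mem_univ i))
    rw [if_neg hi]
  · intro j hj
    refine Finset.sup'_le _ _ fun i _ => ?_
    have hp := extendZero_pair_le_one hd w j
    have hmul : (1 - extendZero d w j - extendZero d j w) * extendZero d j (σ j) ≤
        1 - extendZero d w j - extendZero d j w :=
      mul_le_of_le_one_right (by linarith) (hle _ _)
    split_ifs with hi
    · linarith [hnn j w]
    · by_cases hij : i = j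
      · subst hij
        -- For `i = j`, upper minus lower bound is exactly this product.
        have := mul_nonneg (sub_nonneg.2 (hle i (σ i)))
          (by linarith [hnn i w, hnn w i] :
            0 ≤ 2 - extendZero d w i - extendZero d i w)
        linarith
      -- For `i ≠ j`, the bounds compare through the triangle `i → w → j → i` and two arcs of `σ`.
      · have h1 := extendZero_path_le_one hd hij hi hj
        have h2 : extendZero d i (σ i) + extendZero d j (σ j) ≤ 1 := by
          refine le_trans ?_ (sum_extendZero_le_one hd hσ)
          rw [← Finset.sum_pair (f := fun t => extendZero d t (σ t)) hij]
          exact Finset.sum_le_sum_of_subset_of_nonneg (subset_univ _) fun t _ _ => hnn _ _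
        have h3 : (1 - extendZero d w j - extendZero d j w) * extendZero d j (σ j) ≤
            extendZero d j (σ j) :=
          mul_le_of_le_one_left (hnn _ _) (by linarith [hnn j w, hnn w j])
        linarith

theorem tightBlock_constraint {d : Arc (Node₁ n) → ℝ} (hd : d ∈ paramD n)
    {σ : Equiv.Perm (Node₁ n)} {w : Node₁ n} {U : ℝ} (hσσ : ∀ i, i ≠ w → σ (σ i) ≠ i)
    (hU : ∀ i, i ≠ w → extendZero d i (σ i) + extendZero d i w - 1 ≤ U)
    (hU' : ∀ j, j ≠ w → U ≤ 1 - extendZero d w j -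
        (1 - extendZero d w j - extendZero d j w) * extendZero d j (σ j))
    {i j : Node₁ n} (hij : i ≠ j) :
    (if i = w then U else 0) - (if j = w then U else 0) + tightBlock d σ w i j +
      (1 - extendZero d i j - extendZero d j i) * tightBlock d σ w j i ≤
        1 - extendZero d i j := by
  have hnn := extendZero_nonneg hd
  have hle := extendZero_le_one hd
  unfold tightBlock
  by_cases hi : i = w
  · subst hi
    have := hU' j hij.symm
    simp only [if_true, if_neg hij.symm]
    linarith
  · by_cases hj : j = w
    · subst hj
      have := hU i hi
      simp only [if_true, if_neg hi, mul_zero]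
      linarith
    · simp only [if_neg hi, if_neg hj]
      by_cases h1 : j = σ i
      · have h2 : i ≠ σ j := fun h => hσσ i hi (by rw [← h1, ← h])
        rw [if_pos h1, if_neg h2]
        linarith
      · rw [if_neg h1]
        split_ifs
        · have hp := extendZero_pair_le_one hd i j
          have := mul_le_of_le_one_right
            (by linarith : 0 ≤ 1 - extendZero d i j - extendZero d j i)
            (by linarith [hnn j i] : 1 - extendZero d j i ≤ 1)
          linarith [hnn j i]
        · linarith [hle i j]

theorem not_polyPDL_subset_of_isCycle (hn : 5 ≤ n) {d δ : Arc (Node₁ n) → ℝ} (hd : d ∈ paramD n)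
    {σ : Equiv.Perm (Node₁ n)} {w : Node₁ n} (hσ : σ.IsCycle) (hsupp : σ.support = {w}ᶜ)
    (hpos : 0 < ∑ i, extendZero δ i (σ i)) :
    ¬ polyPDL n d ⊆ polyPDL n (d + δ) := by
  have hn0 : 0 < n := by omega
  have hσw : σ w = w := Equiv.Perm.notMem_support.1 (by simp [hsupp])
  have hmv : ∀ i, i ≠ w → σ i ≠ i := fun i hi => Equiv.Perm.mem_support.1 (by simp [hsupp, hi])
  have hσ_ne : ∀ i, i ≠ w → σ i ≠ w := fun i hi h => hi (σ.injective (h.trans hσw.symm))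
  -- `σ` has length `n - 2 ≥ 3`, so no arc of the cycle has its reverse in the cycle.
  have hσσ : ∀ i, i ≠ w → σ (σ i) ≠ i := by
    intro i hi h
    have h1 : σ ^ 2 = 1 := hσ.pow_eq_one_iff.2 ⟨i, hmv i hi, by simpa [pow_two] using h⟩
    have h2 := Nat.le_of_dvd (by norm_num) (orderOf_dvd_of_pow_eq_one h1)
    rw [hσ.orderOf, hsupp, Finset.card_compl, Finset.card_singleton, card_node₁ hn0] at h2
    omega
  obtain ⟨U, hU, hU'⟩ := exists_label (w := w) hd hσ
  obtain ⟨y, hy, hyb⟩ := exists_mem_assignmentPolytope hn0 hd hσ hsupp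
  intro hsub
  obtain ⟨⟨x, u⟩, ⟨-, hu⟩, hx⟩ := hsub ⟨(y, fun i => if i = w then U else 0),
    ⟨hy, fun a => by
      have h := tightBlock_constraint hd hσσ hU hU' a.2
      rw [extendZero_arc d a, show extendZero d a.1.2 a.1.1 = d a.rev from
        extendZero_arc d a.rev] at h
      simp only [hyb]
      exact h⟩, rfl⟩
  dsimp only at hx hu
  subst hx
  simp only [hyb] at hu
  -- On a cycle arc `x = 1 - d` and the reverse arc has `x = 0`, so the constraint for `d + δ`
  -- leaves only `δ` against the labels.
  have key : ∀ i, extendZero δ i (σ i) ≤ u (σ i) - u i := by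
    intro i
    by_cases hi : i = w
    · rw [hi, hσw, extendZero_self, sub_self]
    · have h := hu ⟨(i, σ i), (hmv i hi).symm⟩
      have h1 : tightBlock d σ w i (σ i) = 1 - d ⟨(i, σ i), (hmv i hi).symm⟩ := by
        simp [tightBlock, hi, hσ_ne i hi, extendZero_of_ne d (hmv i hi).symm]
      have h2 : tightBlock d σ w (σ i) i = 0 := by
        simp [tightBlock, hi, hσ_ne i hi, (hσσ i hi).symm]
      simp only [Arc.rev, h1, h2, mul_zero, Pi.add_apply] at h
      rw [extendZero_of_ne δ (hmv i hi).symm]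
      linarith
  have hle := Finset.sum_le_sum fun i (_ : i ∈ univ) => key i
  rw [Finset.sum_sub_distrib, Equiv.sum_comp σ u, sub_self] at hle
  linarith

end Point

end ATSP

theorem mainTheorem11 (n : ℕ) (hn : 5 ≤ n)
    (d δ : ATSP.Arc (ATSP.Node₁ n) → ℝ)
    (hd : d ∈ ATSP.paramD n) (hδ : δ ≠ 0) (hdδ : d + δ ∈ ATSP.paramD n)
    (hanti : ∀ a : ATSP.Arc (ATSP.Node₁ n), δ a = -δ a.rev)
    (hC : ∃ C ∈ ATSP.cycles₁ n, 3 ≤ C.card ∧ ∑ a ∈ C, δ a ≠ 0) :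
    ¬ ATSP.polyPDL n d ⊆ ATSP.polyPDL n (d + δ) ∧
      ¬ ATSP.polyPDL n (d + δ) ⊆ ATSP.polyPDL n d := by
  obtain ⟨C, hC, -, hne⟩ := hC
  have hcard : 4 ≤ Fintype.card (ATSP.Node₁ n) := by
    rw [ATSP.card_node₁ (by omega)]
    omega
  obtain ⟨σ, w, hσ, hsupp, hsum⟩ := ATSP.exists_isCycle_sum_ne_zero hcard hanti hC hne
  have hinv : ∑ i, ATSP.extendZero δ i (σ⁻¹ i) = -∑ i, ATSP.extendZero δ i (σ i) := by
    rw [← Equiv.sum_comp σ, ← Finset.sum_neg_distrib]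
    refine Finset.sum_congr rfl fun i _ => ?_
    rw [← Equiv.Perm.mul_apply, inv_mul_cancel, Equiv.Perm.one_apply]
    exact ATSP.extendZero_antisymm hanti _ _
  have key : ∀ {d δ : ATSP.Arc (ATSP.Node₁ n) → ℝ}, d ∈ ATSP.paramD n →
      (∑ i, ATSP.extendZero δ i (σ⁻¹ i) = -∑ i, ATSP.extendZero δ i (σ i)) →
      ∑ i, ATSP.extendZero δ i (σ i) ≠ 0 → ¬ ATSP.polyPDL n d ⊆ ATSP.polyPDL n (d + δ) := by
    intro d δ hd hinv hsum
    rcases lt_or_gt_of_ne hsum with h | h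
    · exact ATSP.not_polyPDL_subset_of_isCycle hn hd hσ.inv
        ((Equiv.Perm.support_inv σ).trans hsupp) (by rw [hinv]; linarith)
    · exact ATSP.not_polyPDL_subset_of_isCycle hn hd hσ hsupp h
  refine ⟨key hd hinv hsum, ?_⟩
  -- The hypotheses are symmetric under exchanging `d` with `d + δ` and `δ` with `-δ`.
  have h2 := key (d := d + δ) (δ := -δ) hdδ
    (by simp only [ATSP.extendZero_neg, Finset.sum_neg_distrib, hinv])
    (by simpa only [ATSP.extendZero_neg, Finset.sum_neg_distrib, neg_ne_zero] using hsum)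
  rwa [add_neg_cancel_right] at h2
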